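/- Let $(X,d)$ be a compact metric space that is a fractal quantum graph with length system $(\Phi_k,\ell_k)_{k\ge 1}$. That is, $\ell_k>0$, and $\Phi_k:[0,\ell_k]\to X$ are embeddings such that: - $\Phi_k|_{(0,\ell_k)}$ is a local isometry in the sense that for every $x\in(0,\ell_k)$ there is $\varepsilon>0$ with $d(\Phi_k(x),\Phi_k(y))=|x-y|$ for all $y\in(0,\ell_k)$ with $|y-x|<\varepsilon$; - $\Phi_j((0,\ell_j))\cap\Phi_k((0,\ell_k))=\emptyset$ for $j\ne k$; - for $j<k$ the end points $\Phi_k(0),\Phi_k(\ell_k)$ do not lie in $\Phi_j((0,\ell_j))$; - with $J_n=\bigcup_{k=1}^n\Phi_k((0,\ell_k))$ and $J_n^c=X\setminus J_n$, the set $\bigcap_{n} J_n^c$ is compact and totally disconnected. Let $\mathcal F_n$ be the set of functions $f:X\to\mathbb R$ such that $f\circ\Phi_k\in H^1([0,\ell_k])$ for all $k\le n$ (that is, $f\circ\Phi_k$ is absolutely continuous with square integrable derivative) and $f|_{J_n^c}$ is locally constant for the relative topology of $J_n^c$. Let $\mathcal F_*=\bigcup_{n\ge1}\mathcal F_n$ and,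 for $f,g\in\mathcal F_*$, $$\mathscr E_*(f,g)=\sum_{k=1}^\infty\int_0^{\ell_k}(f\circ\Phi_k)'(t)\,(g\circ\Phi_k)'(t)\,dt .$$ For $x,y\in X$ let $$R_n(x,y)=\sup\left\{\frac{|f(x)-f(y)|^2}{\mathscr E_*(f,f)} : f\in\mathcal F_n,\ \mathscr E_*(f,f)\neq0\right\}\in[0,\infty].$$ A resistance form on $X$ is a non-negative symmetric bilinear form $\mathscr E$ on a linear space $\operatorname{dom}\mathscr E$ of functions $X\to\mathbb R$ such that - $\operatorname{dom}\mathscr E$ contains the constants, and $\mathscr E(u,u)=0$ if and only if $u$ is constant; - $\operatorname{dom}\mathscr E$ modulo constants is a Hilbert space with inner product $\mathscr E$; - $\operatorname{dom}\mathscr E$ separates the points of $X$; - $R_{\mathscr E}(p,q)=\sup\{(u(p)-u(q))^2/\mathscr E(u,u): u\in\operatorname{dom}\mathscr E,\ \mathscr E(u,u)\ne0\}<\infty$ for all $p,q\in X$; - for $u\in\operatorname{dom}\mathscr E$ the function $\bar u=\max(0,\min(u,1))$ is in $\operatorname{dom}\mathscr E$ and $\mathscr E(\bar u,\bar u)\le\mathscr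 E(u,u)$. The function $R_{\mathscr E}$ is called the resistance metric of $\mathscr E$. Then the following statements are equivalent: 1. $R_n(x,y)$ converges, for all $x,y\in X$, to $R(x,y)$, where $R$ is a metric on $X$ with the same topology as $d$. 2. There is a resistance form $\mathscr E$ on $X$ with resistance metric $R_{\mathscr E}(x,y)=\lim_{n\to\infty}R_n(x,y)$ for all $x,y\in X$, this metric induces the same topology as $d$, $\mathcal F_*\subset\operatorname{dom}\mathscr E$, $\mathscr E(f,f)=\mathscr E_*(f,f)$ for all $f\in\mathcal F_*$, and for every $g\in\operatorname{dom}\mathscr E$ there are $f_1,f_2,\ldots\in\mathcal F_*$ with $\lim_{i\to\infty}\mathscr E(f_i-g,f_i-g)=0$. -/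

import Mathlib

open Set Filter Topology MeasureTheory
open scoped ENNReal

/-- The function `h`, restricted to `[0, ℓ]`, belongs to the Sobolev space `H¹([0, ℓ])`
(for the continuous representative): it is absolutely continuous on `[0, ℓ]` and its
derivative (which exists almost everywhere) is square integrable. -/
def MemHOne (ℓ : ℝ) (h : ℝ → ℝ) : Prop :=
  AbsolutelyContinuousOnInterval h 0 ℓ ∧ MemLp (deriv h) 2 (volume.restrict (Ioo 0 ℓ))

/-- A length system on the (compact) metric space `X`: positive lengths `ℓ k` and embeddings
`Φ k : [0, ℓ k] → X` of closed intervals, which makes `X` a fractal quantum graph.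
The values of `Φ k` outside `[0, ℓ k]` play no role. -/
structure LengthSystem (X : Type*) [MetricSpace X] where
  /-- the lengths -/
  ℓ : ℕ → ℝ
  /-- the embeddings of the intervals `[0, ℓ k]` -/
  Φ : ℕ → ℝ → X
  ℓ_pos : ∀ k, 0 < ℓ k
  isEmbedding : ∀ k, IsEmbedding ((Icc 0 (ℓ k)).domRestrict (Φ k))
  local_isometry : ∀ k, ∀ x ∈ Ioo 0 (ℓ k), ∃ ε > 0, ∀ y ∈ Ioo 0 (ℓ k),
    |y - x| < ε → dist (Φ k x) (Φ k y) = |x - y|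
  disjoint : ∀ j k, j ≠ k → Disjoint (Φ j '' Ioo 0 (ℓ j)) (Φ k '' Ioo 0 (ℓ k))
  /-- the end points of an edge do not lie in the interior of an earlier edge -/
  endpoints : ∀ j k, j < k →
    Φ k 0 ∉ Φ j '' Ioo 0 (ℓ j) ∧ Φ k (ℓ k) ∉ Φ j '' Ioo 0 (ℓ j)
  isCompact_iInter : IsCompact (⋂ k, (Φ k '' Ioo 0 (ℓ k))ᶜ)
  isTotallyDisconnected_iInter : IsTotallyDisconnected (⋂ k, (Φ k '' Ioo 0 (ℓ k))ᶜ)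

namespace LengthSystem

variable {X : Type*} [MetricSpace X] (G : LengthSystem X)

/-- The union `J n` of the first open edges. Edges are numbered from `0`, so that `J n` is the
union of the edges with numbers `0, …, n`. -/
def J (n : ℕ) : Set X :=
  ⋃ k ≤ n, G.Φ k '' Ioo 0 (G.ℓ k)

/-- The space `𝓕 n` of the functions which are `H¹` on the edges `0, …, n` and locally
constant on the complement of `J n` (in its relative topology). -/
def levelSpace (n : ℕ) : Set (X → ℝ) :=
  {f | (∀ k ≤ n, MemHOne (G.ℓ k) (fun t => f (G.Φ k t))) ∧
    IsLocallyConstant (((G.J n)ᶜ).domRestrict f)}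

/-- The union `𝓕_*` of all the spaces `𝓕 n`. -/
def unionSpace : Set (X → ℝ) :=
  ⋃ n, G.levelSpace n

/-- The energy `𝓔_*(f, g) = ∑ₖ ∫₀^{ℓ k} (f ∘ Φ k)' (g ∘ Φ k)' dt`. For `f` and `g` in `𝓕_*`
only finitely many terms are different from zero. -/
noncomputable def energy (f g : X → ℝ) : ℝ :=
  ∑' k, ∫ t in (0 : ℝ)..(G.ℓ k),
    deriv (fun s => f (G.Φ k s)) t * deriv (fun s => g (G.Φ k s)) t

/-- The effective resistance `R n x y` of the energy restricted to `𝓕 n`, a supremum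
in `[0, ∞]`. -/
noncomputable def levelResistance (n : ℕ) (x y : X) : ℝ≥0∞ :=
  ⨆ f ∈ {f | f ∈ G.levelSpace n ∧ G.energy f f ≠ 0},
    ENNReal.ofReal (|f x - f y| ^ 2 / G.energy f f)

end LengthSystem

/-- A resistance form on the set `X`. -/
structure ResistanceForm (X : Type*) where
  /-- the domain, a linear space of real functions on `X` -/
  dom : Submodule ℝ (X → ℝ)
  /-- the bilinear form -/
  form : LinearMap.BilinForm ℝ dom
  symm : ∀ u v, form u v = form v u
  nonneg : ∀ u, 0 ≤ form u u
  const_mem : ∀ c : ℝ, (fun _ => c) ∈ dom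
  form_self_eq_zero_iff : ∀ u : dom, form u u = 0 ↔ ∃ c : ℝ, ∀ x, (u : X → ℝ) x = c
  /-- completeness of `dom` modulo constants in the norm given by `form` -/
  complete : ∀ u : ℕ → dom,
    (∀ ε > 0, ∃ N, ∀ m ≥ N, ∀ n ≥ N, form (u m - u n) (u m - u n) < ε) →
    ∃ v : dom, Tendsto (fun n => form (u n - v) (u n - v)) atTop (𝓝 0)
  separates : ∀ p q, p ≠ q → ∃ u : dom, (u : X → ℝ) p ≠ (u : X → ℝ) q
  bddAbove : ∀ p q, BddAbove {r : ℝ | ∃ u : dom, form u u ≠ 0 ∧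
    r = ((u : X → ℝ) p - (u : X → ℝ) q) ^ 2 / form u u}
  /-- the Markov property -/
  markov : ∀ u : dom, ∃ h : (fun x => max 0 (min ((u : X → ℝ) x) 1)) ∈ dom,
    form ⟨_, h⟩ ⟨_, h⟩ ≤ form u u

/-- The effective resistance between two points (the resistance metric). -/
noncomputable def ResistanceForm.resistance {X : Type*} (E : ResistanceForm X) (p q : X) : ℝ :=
  sSup {r : ℝ | ∃ u : E.dom, E.form u u ≠ 0 ∧
    r = ((u : X → ℝ) p - (u : X → ℝ) q) ^ 2 / E.form u u}

/-- `R` is a metric on `X`. -/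
structure IsMetricFun {X : Type*} (R : X → X → ℝ) : Prop where
  eq_zero_iff : ∀ x y, R x y = 0 ↔ x = y
  nonneg : ∀ x y, 0 ≤ R x y
  symm : ∀ x y, R x y = R y x
  triangle : ∀ x y z, R x z ≤ R x y + R y z

/-- The topology defined by the balls of `R` is the given topology of `X`. -/
def InducesTopology {X : Type*} [TopologicalSpace X] (R : X → X → ℝ) : Prop :=
  ∀ s : Set X, IsOpen s ↔ ∀ x ∈ s, ∃ ε > 0, ∀ y, R x y < ε → y ∈ s

/-!
The energy is closed in a Hilbert space and the closure is described by kernel vectors. The gradient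
of a function `f` in `unionSpace` is the family of derivatives of `f` along the edges, an element of
the Hilbert sum `EdgeL2` of the spaces `L²(0, ℓ k)`. The energy is the inner product of gradients,
and `gradSpace` is the closure of the set of all gradients.

Suppose that the effective resistances converge to a finite function `R` with `R x y ≠ 0` for
`x ≠ y`. As they increase with the level, `(f x - f y) ^ 2 ≤ R x y * energy f f` on `unionSpace`
(`ResistanceLimit.sq_sub_le`). Hence `f x - f p`, for a fixed point `p`, is the inner product of the
gradient of `f` with a vector `kernel x` of `gradSpace`, and `‖kernel x - kernel y‖ ^ 2 = R x y`.
By the fundamental theorem of calculus the integral of a gradient over an initial segment of an edge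
is its inner product with a difference of two kernel vectors. By continuity this holds on
`gradSpace`, so that a vector orthogonal to all kernel vectors is zero
(`ResistanceLimit.eq_zero_of_inner_kernel_eq_zero`). Therefore the functions
`x ↦ ⟪kernel x, h⟫ + c` determine `h`, and with the energy `‖h‖ ^ 2` they form a Hilbert space modulo
constants, in which `unionSpace` is dense, with resistance metric `R`. The Markov property passes
from `unionSpace` to this closure (`KernelRealization.dom_markov`), since membership in a
reproducing kernel Hilbert space with a norm bound is preserved under pointwise limits.

Conversely, for a given resistance form whose resistance metric is the limit of the effective
resistances, only the triangle inequality requires an argument. It is obtained from the same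
construction: by the Markov property, the function with gradient `kernel x - kernel y` attains its
maximum at `x` and its minimum at `y`, and this says that `kernel x - kernel y` and
`kernel y - kernel z` have a non-positive inner product. The topology of the metric is the same in
both statements.
-/

/-! ### Kernel realizations of quadratic forms -/

section KernelRealization

/-- A form of the Riesz representation theorem relative to a linear map `T` into a Hilbert space:
a functional dominated by `M * ‖T ·‖` factors through `T`, and is represented by a vector of norm
at most `M`. For the map `T` of finitely supported functions onto combinations of kernel functions
this is Aronszajn's characterization of the functions in a reproducing kernel Hilbert space. -/
theorem exists_inner_eq_of_abs_le {W H : Type*} [AddCommGroup W] [Module ℝ W]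
    [NormedAddCommGroup H] [InnerProductSpace ℝ H] [CompleteSpace H]
    (T : W →ₗ[ℝ] H) (U : W →ₗ[ℝ] ℝ) (M : ℝ) (hM : 0 ≤ M) (h : ∀ w, |U w| ≤ M * ‖T w‖) :
    ∃ v : H, ‖v‖ ≤ M ∧ ∀ w, inner ℝ v (T w) = U w := by
  have hker : LinearMap.ker T ≤ LinearMap.ker U := by
    intro w hw
    have h1 := h w
    rw [LinearMap.mem_ker] at hw ⊢
    rw [hw, norm_zero, mul_zero] at h1
    exact abs_nonpos_iff.1 h1
  let U' : LinearMap.range T →ₗ[ℝ] ℝ :=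
    ((LinearMap.ker T).liftQ U hker) ∘ₗ (T.quotKerEquivRange.symm : _ →ₗ[ℝ] _)
  have hU' : ∀ w (hw : T w ∈ LinearMap.range T), U' ⟨T w, hw⟩ = U w := by
    intro w hw
    simp only [U', LinearMap.comp_apply, LinearEquiv.coe_coe]
    rw [LinearMap.quotKerEquivRange_symm_apply_image]
    simp
  have hb : ∀ y : LinearMap.range T, ‖U' y‖ ≤ M * ‖y‖ := by
    rintro ⟨_, w, rfl⟩
    rw [hU' w ⟨w, rfl⟩]
    exact h w
  obtain ⟨g, hg, hgn⟩ := exists_extension_norm_eq (LinearMap.range T) (U'.mkContinuous M hb)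
  refine ⟨(InnerProductSpace.toDual ℝ H).symm g, ?_, fun w => ?_⟩
  · rw [LinearIsometryEquiv.norm_map, hgn]
    exact LinearMap.mkContinuous_norm_le _ hM _
  · rw [InnerProductSpace.toDual_symm_apply]
    have := hg ⟨T w, w, rfl⟩
    rw [this]
    exact hU' w _

variable {X H : Type*} [NormedAddCommGroup H] [InnerProductSpace ℝ H]

/-- A realization in a Hilbert space `H` of a quadratic form on a space `V` of functions on `X`:
the form is `‖grad f‖ ^ 2`, and differences of values of `f` are inner products of `grad f` with
kernel vectors. That only `0` is orthogonal to all the kernel vectors (`total`) says that the form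
is closable with respect to pointwise convergence. -/
structure KernelRealization (V : Submodule ℝ (X → ℝ)) (H : Type*) [NormedAddCommGroup H]
    [InnerProductSpace ℝ H] where
  /-- the abstract gradient, through which the form is the inner product of `H` -/
  grad : V →ₗ[ℝ] H
  denseRange : DenseRange grad
  /-- the point at which the functions are normalized -/
  base : X
  /-- the vectors which represent evaluation of functions, normalized at `base` -/
  kernel : X → H
  inner_kernel_grad : ∀ (f : V) (x : X), inner ℝ (kernel x) (grad f) = f.1 x - f.1 base
  kernel_injective : Function.Injective kernel
  total : ∀ h : H, (∀ x, inner ℝ (kernel x) h = 0) → h = 0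
  const_mem : ∀ c : ℝ, (fun _ => c) ∈ V
  /-- the Markov property on `V` -/
  markov : ∀ f : V, ∃ h : (fun x => max 0 (min (f.1 x) 1)) ∈ V, ‖grad ⟨_, h⟩‖ ≤ ‖grad f‖

namespace KernelRealization

variable {V : Submodule ℝ (X → ℝ)} (A : KernelRealization V H)

/-- The function with value `c` at the base point and with gradient `h`. -/
noncomputable def potential : (H × ℝ) →ₗ[ℝ] (X → ℝ) where
  toFun q := fun x => inner ℝ (A.kernel x) q.1 + q.2
  map_add' q r := by
    ext x
    simp only [Prod.fst_add, Prod.snd_add, inner_add_right, Pi.add_apply]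
    ring
  map_smul' a q := by
    ext x
    simp only [Prod.smul_fst, Prod.smul_snd, inner_smul_right, Pi.smul_apply, smul_eq_mul,
      RingHom.id_apply]
    ring

theorem kernel_base : A.kernel A.base = 0 := by
  have h : (fun v => inner ℝ (A.kernel A.base) v) = fun _ : H => (0 : ℝ) := by
    refine A.denseRange.equalizer (by fun_prop) (by fun_prop) ?_
    ext f
    simp [A.inner_kernel_grad f A.base]
  exact inner_self_eq_zero.1 (congrFun h (A.kernel A.base))

theorem potential_apply (q : H × ℝ) (x : X) :
    A.potential q x = inner ℝ (A.kernel x) q.1 + q.2 := rfl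

theorem potential_injective : Function.Injective A.potential := by
  rw [← LinearMap.ker_eq_bot, LinearMap.ker_eq_bot']
  rintro ⟨h, c⟩ hq
  have h1 : ∀ x, inner ℝ (A.kernel x) h + c = 0 := fun x => congrFun hq x
  have hc : c = 0 := by simpa [A.kernel_base] using h1 A.base
  have hh : h = 0 := A.total h fun x => by simpa [hc] using h1 x
  rw [hc, hh]
  rfl

/-- The domain of the closure of the form: all functions with a gradient in `H`. -/
noncomputable def dom : Submodule ℝ (X → ℝ) := LinearMap.range A.potential

/-- The gradient on the domain of the closure. -/
noncomputable def domGrad : A.dom →ₗ[ℝ] H :=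
  LinearMap.fst ℝ H ℝ ∘ₗ
    (LinearEquiv.ofInjective A.potential A.potential_injective).symm.toLinearMap

theorem inner_kernel_domGrad (u : A.dom) (x : X) :
    inner ℝ (A.kernel x) (A.domGrad u) = u.1 x - u.1 A.base := by
  obtain ⟨q, rfl⟩ := (LinearEquiv.ofInjective A.potential A.potential_injective).surjective u
  change inner ℝ (A.kernel x) ((LinearEquiv.ofInjective A.potential
    A.potential_injective).symm (LinearEquiv.ofInjective A.potential A.potential_injective q)).1 =
      A.potential q x - A.potential q A.base
  simp [potential_apply, A.kernel_base]

theorem inner_sub_kernel_domGrad (u : A.dom) (x y : X) :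
    inner ℝ (A.kernel x - A.kernel y) (A.domGrad u) = u.1 x - u.1 y := by
  rw [inner_sub_left, A.inner_kernel_domGrad, A.inner_kernel_domGrad]
  ring

theorem sq_sub_div_le (u : A.dom) (x y : X) :
    (u.1 x - u.1 y) ^ 2 / ‖A.domGrad u‖ ^ 2 ≤ ‖A.kernel x - A.kernel y‖ ^ 2 := by
  refine div_le_of_le_mul₀ (sq_nonneg _) (sq_nonneg _) ?_
  rw [← A.inner_sub_kernel_domGrad, ← mul_pow, sq_le_sq,
    abs_of_nonneg (mul_nonneg (norm_nonneg _) (norm_nonneg _))]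
  exact abs_real_inner_le_norm _ _

theorem mem_dom_of_inner_eq {u : X → ℝ} {h : H}
    (hu : ∀ x, inner ℝ (A.kernel x) h = u x - u A.base) : u ∈ A.dom :=
  ⟨(h, u A.base), by ext x; simp [potential_apply, hu x]⟩

theorem domGrad_eq_of_inner_eq {u : A.dom} {h : H}
    (hu : ∀ x, inner ℝ (A.kernel x) h = u.1 x - u.1 A.base) : A.domGrad u = h := by
  refine sub_eq_zero.1 (A.total _ fun x => ?_)
  rw [inner_sub_right, A.inner_kernel_domGrad, hu, sub_self]

theorem domGrad_surjective : Function.Surjective A.domGrad := by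
  intro h
  have hu : ∀ x, inner ℝ (A.kernel x) h =
      inner ℝ (A.kernel x) h - inner ℝ (A.kernel A.base) h := by simp [A.kernel_base]
  exact ⟨⟨fun x => inner ℝ (A.kernel x) h, A.mem_dom_of_inner_eq hu⟩, A.domGrad_eq_of_inner_eq hu⟩

theorem le_dom : V ≤ A.dom := fun f hf =>
  A.mem_dom_of_inner_eq (A.inner_kernel_grad ⟨f, hf⟩)

theorem domGrad_eq_grad {f : X → ℝ} (hf : f ∈ V) : A.domGrad ⟨f, A.le_dom hf⟩ = A.grad ⟨f, hf⟩ :=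
  A.domGrad_eq_of_inner_eq (A.inner_kernel_grad ⟨f, hf⟩)

theorem domGrad_eq_zero_iff (u : A.dom) : A.domGrad u = 0 ↔ ∃ c : ℝ, ∀ x, u.1 x = c := by
  constructor
  · intro h
    refine ⟨u.1 A.base, fun x => ?_⟩
    have := A.inner_kernel_domGrad u x
    rw [h, inner_zero_right] at this
    linarith
  · rintro ⟨c, hc⟩
    exact A.domGrad_eq_of_inner_eq fun x => by simp [hc]

theorem linearCombination_inner_kernel (v : H) (a : X →₀ ℝ) :
    Finsupp.linearCombination ℝ (fun x => (inner ℝ (A.kernel x) v : ℝ)) a =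
      inner ℝ (Finsupp.linearCombination ℝ A.kernel a) v := by
  simp [Finsupp.linearCombination_apply, Finsupp.sum, sum_inner, inner_smul_left]

/-- The Markov property passes to the closure. Truncations of an approximating sequence are
bounded and converge pointwise, and the domination in `exists_inner_eq_of_abs_le` is preserved
under pointwise limits, so that no weak compactness is needed. -/
theorem dom_markov [CompleteSpace H] (u : A.dom) :
    ∃ h : (fun x => max 0 (min (u.1 x) 1)) ∈ A.dom, ‖A.domGrad ⟨_, h⟩‖ ≤ ‖A.domGrad u‖ := by
  obtain ⟨w, hw, hlim⟩ := mem_closure_iff_seq_limit.1 (A.denseRange (A.domGrad u))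
  choose v hv using hw
  -- Adding constants makes the approximating functions agree with `u` at the base point.
  let f : ℕ → V := fun i => v i + ⟨fun _ => u.1 A.base - (v i).1 A.base, A.const_mem _⟩
  have hfbase : ∀ i, (f i).1 A.base = u.1 A.base := fun i => by simp [f]
  have hf : ∀ i, A.grad (f i) = w i := by
    intro i
    rw [← hv i]
    refine sub_eq_zero.1 (A.total _ fun x => ?_)
    rw [inner_sub_right, A.inner_kernel_grad, A.inner_kernel_grad]
    simp only [f, Submodule.coe_add, Pi.add_apply]
    ring
  have hpt : ∀ x, Tendsto (fun i => (f i).1 x) atTop (𝓝 (u.1 x)) := by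
    intro x
    have h1 : ∀ i, (f i).1 x = inner ℝ (A.kernel x) (w i) + u.1 A.base := by
      intro i
      rw [← hf i, A.inner_kernel_grad, hfbase]
      ring
    have h2 : u.1 x = inner ℝ (A.kernel x) (A.domGrad u) + u.1 A.base := by
      rw [A.inner_kernel_domGrad]
      ring
    simp only [h1]
    rw [h2]
    exact (tendsto_const_nhds.inner hlim).add_const _
  choose hm hle using fun i => A.markov (f i)
  set ub : X → ℝ := fun x => max 0 (min (u.1 x) 1) with hub
  have hptb : ∀ x, Tendsto (fun i => max 0 (min ((f i).1 x) 1)) atTop (𝓝 (ub x)) := fun x =>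
    tendsto_const_nhds.max ((hpt x).min tendsto_const_nhds)
  obtain ⟨h, hh, hinner⟩ := exists_inner_eq_of_abs_le (Finsupp.linearCombination ℝ A.kernel)
    (Finsupp.linearCombination ℝ fun x => ub x - ub A.base) ‖A.domGrad u‖ (norm_nonneg _) (by
      intro a
      have hl : Tendsto (fun i => |Finsupp.linearCombination ℝ
          (fun x => max 0 (min ((f i).1 x) 1) - max 0 (min ((f i).1 A.base) 1)) a|) atTop
          (𝓝 |Finsupp.linearCombination ℝ (fun x => ub x - ub A.base) a|) := by
        simp only [Finsupp.linearCombination_apply, Finsupp.sum]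
        exact (tendsto_finsetSum _ fun x _ =>
          ((hptb x).sub (hptb A.base)).const_smul (a x)).abs
      refine le_of_tendsto_of_tendsto' hl
        (hlim.norm.mul_const ‖Finsupp.linearCombination ℝ A.kernel a‖) fun i => ?_
      have h1 : (fun x => max 0 (min ((f i).1 x) 1) - max 0 (min ((f i).1 A.base) 1)) =
          fun x => inner ℝ (A.kernel x) (A.grad ⟨_, hm i⟩) :=
        funext fun x => (A.inner_kernel_grad ⟨_, hm i⟩ x).symm
      rw [h1, A.linearCombination_inner_kernel]
      calc _ ≤ _ := abs_real_inner_le_norm _ _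
        _ ≤ ‖Finsupp.linearCombination ℝ A.kernel a‖ * ‖w i‖ := by
          rw [← hf i]
          gcongr
          exact hle i
        _ = _ := mul_comm _ _)
  have hub' : ∀ x, inner ℝ (A.kernel x) h = ub x - ub A.base := by
    intro x
    have := hinner (Finsupp.single x 1)
    simp only [Finsupp.linearCombination_single, one_smul] at this
    rw [real_inner_comm]
    exact this
  refine ⟨A.mem_dom_of_inner_eq hub', ?_⟩
  rw [A.domGrad_eq_of_inner_eq (u := ⟨ub, A.mem_dom_of_inner_eq hub'⟩) hub']
  exact hh

/-- The potential `u` with gradient `kernel x - kernel y` attains its maximum at `x` and its minimum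
at `y`. After an affine change, `u y = 0` and `u x = 1`, and the truncation of `u` to `[0, 1]` has
the same values at `x` and `y`, but no larger energy. By the equality case of the Cauchy-Schwarz
inequality it has the same gradient as `u`, and therefore agrees with `u`. -/
theorem inner_kernel_sub_mem_Icc [CompleteSpace H] (x y z : X) :
    inner ℝ (A.kernel z) (A.kernel x - A.kernel y) ∈
      Icc (inner ℝ (A.kernel y) (A.kernel x - A.kernel y))
        (inner ℝ (A.kernel x) (A.kernel x - A.kernel y)) := by
  set g := A.kernel x - A.kernel y with hg
  rcases eq_or_ne g 0 with h0 | h0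
  · simp [h0]
  have hpos : 0 < ‖g‖ ^ 2 := by positivity
  have hxy : inner ℝ (A.kernel x) g - inner ℝ (A.kernel y) g = ‖g‖ ^ 2 := by
    rw [← inner_sub_left, ← hg, real_inner_self_eq_norm_sq]
  let u : X → ℝ := fun w => (‖g‖ ^ 2)⁻¹ * (inner ℝ (A.kernel w) g - inner ℝ (A.kernel y) g)
  have hu : ∀ w, inner ℝ (A.kernel w) ((‖g‖ ^ 2)⁻¹ • g) = u w - u A.base := by
    intro w
    simp only [u, inner_smul_right, A.kernel_base, inner_zero_left]
    ring
  have hux : u x = 1 := by simp only [u, hxy, inv_mul_cancel₀ hpos.ne']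
  have huy : u y = 0 := by simp [u]
  have hgrad := A.domGrad_eq_of_inner_eq (u := ⟨u, A.mem_dom_of_inner_eq hu⟩) hu
  obtain ⟨hm, hle⟩ := A.dom_markov ⟨u, A.mem_dom_of_inner_eq hu⟩
  rw [hgrad] at hle
  set v := A.domGrad ⟨_, hm⟩ with hv
  have hgv : inner ℝ g v = 1 := by
    refine (A.inner_sub_kernel_domGrad ⟨_, hm⟩ x y).trans ?_
    simp [hux, huy]
  have hveq : v = (‖g‖ ^ 2)⁻¹ • g := by
    have hn : ‖(‖g‖ ^ 2)⁻¹ • g‖ ^ 2 = (‖g‖ ^ 2)⁻¹ := by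
      rw [norm_smul, norm_inv, norm_pow, norm_norm, mul_pow]
      field_simp
    have h1 : ‖v - (‖g‖ ^ 2)⁻¹ • g‖ ^ 2 ≤ 0 := by
      rw [norm_sub_sq_real, inner_smul_right, real_inner_comm, hgv, hn]
      have : ‖v‖ ^ 2 ≤ (‖g‖ ^ 2)⁻¹ := hn ▸ pow_le_pow_left₀ (norm_nonneg _) hle 2
      linarith
    exact sub_eq_zero.1 (norm_eq_zero.1 (pow_eq_zero_iff two_ne_zero |>.1
      (le_antisymm h1 (sq_nonneg _))))
  have huz : u z = max 0 (min (u z) 1) := by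
    have h1 := A.inner_sub_kernel_domGrad ⟨_, hm⟩ z y
    have h2 := A.inner_sub_kernel_domGrad ⟨u, A.mem_dom_of_inner_eq hu⟩ z y
    rw [← hv, hveq] at h1
    rw [hgrad, h1] at h2
    simpa [huy] using h2.symm
  have h0 : 0 ≤ u z := huz ▸ le_max_left _ _
  have h1 : u z ≤ 1 := huz ▸ max_le zero_le_one (min_le_right _ _)
  have huz' : ‖g‖ ^ 2 * u z = inner ℝ (A.kernel z) g - inner ℝ (A.kernel y) g := by
    simp only [u]
    field_simp
  constructor
  · have := mul_nonneg hpos.le h0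
    linarith
  · have := mul_le_mul_of_nonneg_left h1 hpos.le
    linarith

theorem norm_kernel_sub_sq_triangle [CompleteSpace H] (x y z : X) :
    ‖A.kernel x - A.kernel z‖ ^ 2 ≤
      ‖A.kernel x - A.kernel y‖ ^ 2 + ‖A.kernel y - A.kernel z‖ ^ 2 := by
  have h1 := (A.inner_kernel_sub_mem_Icc x y z).1
  have h2 := (A.inner_kernel_sub_mem_Icc y z x).2
  have h3 : inner ℝ (A.kernel x - A.kernel y) (A.kernel y - A.kernel z) ≤ (0 : ℝ) := by
    rw [inner_sub_left]
    linarith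
  have h4 : A.kernel x - A.kernel z = (A.kernel x - A.kernel y) + (A.kernel y - A.kernel z) := by
    abel
  rw [h4, norm_add_sq_real]
  linarith

/-- The closure of the form is a resistance form. -/
noncomputable def toResistanceForm [CompleteSpace H] : ResistanceForm X where
  dom := A.dom
  form := (innerₗ H).compl₁₂ A.domGrad A.domGrad
  symm u v := by
    simp only [LinearMap.compl₁₂_apply, innerₗ_apply_apply]
    exact real_inner_comm _ _
  nonneg u := real_inner_self_nonneg
  const_mem c := A.le_dom (A.const_mem c)
  form_self_eq_zero_iff u := by
    simp only [LinearMap.compl₁₂_apply, innerₗ_apply_apply, inner_self_eq_zero]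
    exact A.domGrad_eq_zero_iff u
  complete u hu := by
    simp only [LinearMap.compl₁₂_apply, innerₗ_apply_apply, real_inner_self_eq_norm_sq] at hu ⊢
    simp only [map_sub A.domGrad] at hu ⊢
    have hc : CauchySeq fun n => A.domGrad (u n) := by
      refine Metric.cauchySeq_iff.2 fun ε hε => ?_
      obtain ⟨N, hN⟩ := hu (ε ^ 2) (by positivity)
      refine ⟨N, fun m hm n hn => ?_⟩
      rw [dist_eq_norm]
      exact lt_of_pow_lt_pow_left₀ 2 hε.le (hN m hm n hn)
    obtain ⟨h, hh⟩ := cauchySeq_tendsto_of_complete hc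
    obtain ⟨v, rfl⟩ := A.domGrad_surjective h
    refine ⟨v, ?_⟩
    simpa using ((hh.sub_const (A.domGrad v)).norm.pow 2)
  separates p q hpq := by
    obtain ⟨u, hu⟩ := A.domGrad_surjective (A.kernel p - A.kernel q)
    refine ⟨u, fun h => hpq (A.kernel_injective (sub_eq_zero.1 ?_))⟩
    have := A.inner_sub_kernel_domGrad u p q
    rw [hu, h, sub_self] at this
    exact inner_self_eq_zero.1 this
  bddAbove p q := by
    refine ⟨‖A.kernel p - A.kernel q‖ ^ 2, ?_⟩
    rintro r ⟨u, -, rfl⟩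
    simp only [LinearMap.compl₁₂_apply, innerₗ_apply_apply, real_inner_self_eq_norm_sq]
    exact A.sq_sub_div_le u p q
  markov u := by
    obtain ⟨h, hle⟩ := A.dom_markov u
    refine ⟨h, ?_⟩
    simp only [LinearMap.compl₁₂_apply, innerₗ_apply_apply, real_inner_self_eq_norm_sq]
    exact pow_le_pow_left₀ (norm_nonneg _) hle 2

theorem toResistanceForm_form_self [CompleteSpace H] (u : A.toResistanceForm.dom) :
    A.toResistanceForm.form u u = ‖A.domGrad u‖ ^ 2 := real_inner_self_eq_norm_sq _

theorem toResistanceForm_resistance [CompleteSpace H] (x y : X) :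
    A.toResistanceForm.resistance x y = ‖A.kernel x - A.kernel y‖ ^ 2 := by
  refine le_antisymm (Real.sSup_le ?_ (sq_nonneg _)) ?_
  · rintro r ⟨u, -, rfl⟩
    rw [A.toResistanceForm_form_self]
    exact A.sq_sub_div_le u x y
  · obtain ⟨u, hu⟩ : ∃ u : A.toResistanceForm.dom, A.domGrad u = A.kernel x - A.kernel y :=
      A.domGrad_surjective _
    rcases eq_or_ne (A.kernel x - A.kernel y) 0 with h0 | h0
    · rw [h0, norm_zero, zero_pow two_ne_zero]
      refine Real.sSup_nonneg ?_
      rintro r ⟨u, -, rfl⟩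
      exact div_nonneg (sq_nonneg _) (A.toResistanceForm.nonneg u)
    · refine le_csSup (A.toResistanceForm.bddAbove x y) ⟨u, ?_, ?_⟩
      · rw [A.toResistanceForm_form_self, hu]
        positivity
      · have := A.inner_sub_kernel_domGrad u x y
        rw [A.toResistanceForm_form_self, ← this, hu, real_inner_self_eq_norm_sq]
        have : ‖A.kernel x - A.kernel y‖ ≠ 0 := norm_ne_zero_iff.2 h0
        field_simp

theorem exists_tendsto_form_sub [CompleteSpace H] (g : A.toResistanceForm.dom) :
    ∃ f : ℕ → A.toResistanceForm.dom, (∀ i, (f i : X → ℝ) ∈ V) ∧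
      Tendsto (fun i => A.toResistanceForm.form (f i - g) (f i - g)) atTop (𝓝 0) := by
  obtain ⟨w, hw, hlim⟩ := mem_closure_iff_seq_limit.1 (A.denseRange (A.domGrad g))
  choose v hv using hw
  let f : ℕ → A.toResistanceForm.dom := fun i => ⟨(v i).1, A.le_dom (v i).2⟩
  refine ⟨f, fun i => (v i).2, ?_⟩
  have h1 : ∀ i, A.toResistanceForm.form (f i - g) (f i - g) = ‖w i - A.domGrad g‖ ^ 2 := by
    intro i
    rw [A.toResistanceForm_form_self, ← hv i, ← A.domGrad_eq_grad (v i).2]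
    exact congrArg (fun h => ‖h‖ ^ 2) (map_sub A.domGrad (f i) g)
  simp only [h1]
  simpa using ((hlim.sub_const (A.domGrad g)).norm.pow 2)

end KernelRealization

end KernelRealization

/-! ### Sobolev functions on an interval -/

theorem AbsolutelyContinuousOnInterval.congr {f g : ℝ → ℝ} {a b : ℝ}
    (hf : AbsolutelyContinuousOnInterval f a b) (h : EqOn f g (uIcc a b)) :
    AbsolutelyContinuousOnInterval g a b := by
  rw [absolutelyContinuousOnInterval_iff] at hf ⊢
  intro ε hε
  obtain ⟨δ, hδ, H⟩ := hf ε hε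
  refine ⟨δ, hδ, fun E hE hlt => ?_⟩
  convert H E hE hlt using 1
  refine Finset.sum_congr rfl fun i hi => ?_
  rw [h (hE.1 i hi).1, h (hE.1 i hi).2]

theorem LipschitzWith.comp_absolutelyContinuousOnInterval {φ h : ℝ → ℝ} {a b : ℝ}
    (hφ : LipschitzWith 1 φ) (hh : AbsolutelyContinuousOnInterval h a b) :
    AbsolutelyContinuousOnInterval (fun x => φ (h x)) a b := by
  rw [absolutelyContinuousOnInterval_iff] at hh ⊢
  intro ε hε
  obtain ⟨δ, hδ, H⟩ := hh ε hε
  refine ⟨δ, hδ, fun E hE hlt => lt_of_le_of_lt ?_ (H E hE hlt)⟩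
  refine Finset.sum_le_sum fun i _ => ?_
  simpa using hφ.dist_le_mul (h (E.2 i).1) (h (E.2 i).2)

/-- Where `φ ∘ h` is not differentiable the bound holds as the left side is zero. -/
theorem abs_deriv_lipschitz_comp_le {φ h : ℝ → ℝ} (hφ : LipschitzWith 1 φ) {t : ℝ}
    (hh : DifferentiableAt ℝ h t) : |deriv (fun s => φ (h s)) t| ≤ |deriv h t| := by
  by_cases hd : DifferentiableAt ℝ (fun s => φ (h s)) t
  · have h1 := (hasDerivAt_iff_tendsto_slope.1 hd.hasDerivAt).abs
    have h2 := (hasDerivAt_iff_tendsto_slope.1 hh.hasDerivAt).abs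
    refine le_of_tendsto_of_tendsto' h1 h2 fun s => ?_
    rw [slope_def_field, slope_def_field, abs_div, abs_div]
    refine div_le_div_of_nonneg_right ?_ (abs_nonneg _)
    simpa [Real.dist_eq] using hφ.dist_le_mul (h s) (h t)
  · rw [deriv_zero_of_not_differentiableAt hd, abs_zero]
    exact abs_nonneg _

theorem eqOn_deriv_of_eqOn_Icc {f g : ℝ → ℝ} {a b : ℝ} (h : EqOn f g (Icc a b)) :
    EqOn (deriv f) (deriv g) (Ioo a b) := fun _ ht =>
  Filter.EventuallyEq.deriv_eq (h.eventuallyEq_of_mem (Icc_mem_nhds ht.1 ht.2))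

theorem AbsolutelyContinuousOnInterval.ae_restrict_differentiableAt {f : ℝ → ℝ} {a b : ℝ}
    (hf : AbsolutelyContinuousOnInterval f a b) :
    ∀ᵐ t ∂volume.restrict (Ioo a b), DifferentiableAt ℝ f t := by
  rw [ae_restrict_iff' measurableSet_Ioo]
  filter_upwards [hf.ae_differentiableAt] with t ht htab
  exact ht (Icc_subset_uIcc (Ioo_subset_Icc_self htab))

namespace MemHOne

variable {ℓ : ℝ} {f g : ℝ → ℝ}

theorem congr (hℓ : 0 ≤ ℓ) (hf : MemHOne ℓ f) (h : EqOn f g (Icc 0 ℓ)) : MemHOne ℓ g := by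
  refine ⟨hf.1.congr (by rwa [uIcc_of_le hℓ]), hf.2.ae_eq ?_⟩
  filter_upwards [ae_restrict_mem measurableSet_Ioo] with t ht
  exact eqOn_deriv_of_eqOn_Icc h ht

theorem const (ℓ c : ℝ) : MemHOne ℓ (fun _ => c) :=
  ⟨(LipschitzWith.const c).lipschitzOnWith.absolutelyContinuousOnInterval, by simp⟩

theorem deriv_add_ae (hf : MemHOne ℓ f) (hg : MemHOne ℓ g) :
    deriv (fun t => f t + g t) =ᵐ[volume.restrict (Ioo 0 ℓ)] deriv f + deriv g := by
  filter_upwards [hf.1.ae_restrict_differentiableAt, hg.1.ae_restrict_differentiableAt]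
    with t h1 h2
  exact deriv_fun_add h1 h2

theorem add (hf : MemHOne ℓ f) (hg : MemHOne ℓ g) : MemHOne ℓ (fun t => f t + g t) :=
  ⟨hf.1.fun_add hg.1, (hf.2.add hg.2).ae_eq (hf.deriv_add_ae hg).symm⟩

theorem deriv_const_mul_eq (c : ℝ) (f : ℝ → ℝ) : deriv (fun t => c * f t) = c • deriv f := by
  ext t
  simp

theorem const_mul (c : ℝ) (hf : MemHOne ℓ f) : MemHOne ℓ (fun t => c * f t) :=
  ⟨hf.1.const_mul c, by rw [deriv_const_mul_eq]; exact hf.2.const_smul c⟩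

theorem abs_deriv_lipschitz_comp_le_ae {φ : ℝ → ℝ} (hφ : LipschitzWith 1 φ) (hf : MemHOne ℓ f) :
    ∀ᵐ t ∂volume.restrict (Ioo 0 ℓ), |deriv (fun s => φ (f s)) t| ≤ |deriv f t| :=
  hf.1.ae_restrict_differentiableAt.mono fun _ ht => abs_deriv_lipschitz_comp_le hφ ht

theorem lipschitz_comp {φ : ℝ → ℝ} (hφ : LipschitzWith 1 φ) (hf : MemHOne ℓ f) :
    MemHOne ℓ (fun t => φ (f t)) :=
  ⟨hφ.comp_absolutelyContinuousOnInterval hf.1,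
    hf.2.mono (measurable_deriv _).aestronglyMeasurable (hf.abs_deriv_lipschitz_comp_le_ae hφ)⟩

end MemHOne

theorem lipschitzWith_unit_truncation : LipschitzWith 1 fun x : ℝ => max 0 (min x 1) := by
  simpa using (LipschitzWith.id.min_const (1 : ℝ)).const_max 0

/-- A square integrable function on `(0, ℓ)` with vanishing primitive is zero. -/
theorem ae_eq_zero_of_setIntegral_Ioc_eq_zero {ℓ : ℝ} {h : ℝ → ℝ}
    (hh : MemLp h 2 (volume.restrict (Ioo 0 ℓ))) (h0 : ∀ t ∈ Ioo 0 ℓ, ∫ s in Ioc 0 t, h s = 0) :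
    h =ᵐ[volume.restrict (Ioo 0 ℓ)] 0 := by
  rcases le_or_gt ℓ 0 with hℓ | hℓ
  · simp [Ioo_eq_empty_of_le hℓ, Filter.EventuallyEq]
  have hint : IntervalIntegrable h volume 0 ℓ := by
    rw [intervalIntegrable_iff_integrableOn_Ioo_of_le hℓ.le]
    exact hh.integrable one_le_two
  change ∀ᵐ t ∂volume.restrict (Ioo 0 ℓ), h t = 0
  rw [ae_restrict_iff' measurableSet_Ioo]
  filter_upwards [hint.ae_hasDerivAt_integral] with t ht htI
  have h1 := ht (Icc_subset_uIcc (Ioo_subset_Icc_self htI)) 0 (by simp)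
  have h2 : (fun x => ∫ s in (0 : ℝ)..x, h s) =ᶠ[𝓝 t] fun _ => 0 := by
    filter_upwards [isOpen_Ioo.mem_nhds htI] with x hx
    rw [intervalIntegral.integral_of_le hx.1.le]
    exact h0 x hx
  exact h1.unique ((hasDerivAt_const t (0 : ℝ)).congr_of_eventuallyEq h2)

/-! ### The function spaces of a length system -/

namespace LengthSystem

variable {X : Type*} [MetricSpace X] (G : LengthSystem X)

theorem J_mono {m n : ℕ} (h : m ≤ n) : G.J m ⊆ G.J n :=
  biUnion_mono (fun _ hk => le_trans hk h) fun _ _ => le_rfl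

/-- A closed edge does not meet the earlier open edges. -/
theorem image_Icc_subset_compl_J {k n : ℕ} (h : n < k) :
    G.Φ k '' Icc 0 (G.ℓ k) ⊆ (G.J n)ᶜ := by
  rintro _ ⟨t, ht, rfl⟩ hmem
  simp only [J, mem_iUnion] at hmem
  obtain ⟨j, hj, hmem⟩ := hmem
  have hjk : j < k := lt_of_le_of_lt hj h
  rcases eq_or_ne t 0 with rfl | h0
  · exact (G.endpoints j k hjk).1 hmem
  rcases eq_or_ne t (G.ℓ k) with rfl | h1
  · exact (G.endpoints j k hjk).2 hmem
  · exact (G.disjoint j k hjk.ne).le_bot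
      ⟨hmem, t, ⟨lt_of_le_of_ne ht.1 h0.symm, lt_of_le_of_ne ht.2 h1⟩, rfl⟩

variable {G}

theorem eqOn_edge_of_mem_levelSpace {n k : ℕ} {f : X → ℝ} (hf : f ∈ G.levelSpace n) (h : n < k) :
    EqOn (fun _ => f (G.Φ k 0)) (fun t => f (G.Φ k t)) (Icc 0 (G.ℓ k)) := by
  intro t ht
  have hs := G.image_Icc_subset_compl_J h
  let ψ : Icc 0 (G.ℓ k) → ((G.J n)ᶜ : Set X) := fun s => ⟨G.Φ k s, hs ⟨s, s.2, rfl⟩⟩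
  have hψ : Continuous ψ := (G.isEmbedding k).continuous.subtype_mk _
  have : PreconnectedSpace (Icc 0 (G.ℓ k)) := Subtype.preconnectedSpace isPreconnected_Icc
  exact (hf.2.comp_continuous hψ).apply_eq_of_isPreconnected isPreconnected_univ
    (x := ⟨0, le_rfl, (G.ℓ_pos k).le⟩) (y := ⟨t, ht⟩) trivial trivial

theorem memHOne_of_mem_levelSpace {n : ℕ} {f : X → ℝ} (hf : f ∈ G.levelSpace n) (k : ℕ) :
    MemHOne (G.ℓ k) (fun t => f (G.Φ k t)) := by
  rcases le_or_gt k n with h | h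
  · exact hf.1 k h
  · exact (MemHOne.const _ _).congr (G.ℓ_pos k).le (eqOn_edge_of_mem_levelSpace hf h)

theorem levelSpace_mono {m n : ℕ} (h : m ≤ n) : G.levelSpace m ⊆ G.levelSpace n := by
  intro f hf
  refine ⟨fun k _ => memHOne_of_mem_levelSpace hf k, ?_⟩
  exact hf.2.comp_continuous (continuous_inclusion (compl_subset_compl.2 (G.J_mono h)))

theorem memHOne_of_mem_unionSpace {f : X → ℝ} (hf : f ∈ G.unionSpace) (k : ℕ) :
    MemHOne (G.ℓ k) (fun t => f (G.Φ k t)) := by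
  obtain ⟨n, hn⟩ := mem_iUnion.1 hf
  exact memHOne_of_mem_levelSpace hn k

theorem add_mem_levelSpace {n : ℕ} {f g : X → ℝ} (hf : f ∈ G.levelSpace n)
    (hg : g ∈ G.levelSpace n) : f + g ∈ G.levelSpace n :=
  ⟨fun k hk => (hf.1 k hk).add (hg.1 k hk), hf.2.comp₂ hg.2 fun a b => a + b⟩

theorem smul_mem_levelSpace {n : ℕ} {f : X → ℝ} (c : ℝ) (hf : f ∈ G.levelSpace n) :
    c • f ∈ G.levelSpace n :=
  ⟨fun k hk => (hf.1 k hk).const_mul c, hf.2.comp fun a => c * a⟩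

theorem const_mem_levelSpace (n : ℕ) (c : ℝ) : (fun _ => c) ∈ G.levelSpace n :=
  ⟨fun _ _ => MemHOne.const _ c, IsLocallyConstant.const c⟩

theorem lipschitz_comp_mem_levelSpace {n : ℕ} {f : X → ℝ} {φ : ℝ → ℝ} (hφ : LipschitzWith 1 φ)
    (hf : f ∈ G.levelSpace n) : (fun x => φ (f x)) ∈ G.levelSpace n :=
  ⟨fun k hk => (hf.1 k hk).lipschitz_comp hφ, hf.2.comp φ⟩

variable (G)

/-- The linear space with underlying set `unionSpace`. -/
def unionSubmodule : Submodule ℝ (X → ℝ) where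
  carrier := G.unionSpace
  add_mem' {f g} hf hg := by
    obtain ⟨m, hm⟩ := mem_iUnion.1 hf
    obtain ⟨n, hn⟩ := mem_iUnion.1 hg
    exact mem_iUnion.2 ⟨max m n, add_mem_levelSpace (levelSpace_mono (le_max_left m n) hm)
      (levelSpace_mono (le_max_right m n) hn)⟩
  zero_mem' := mem_iUnion.2 ⟨0, const_mem_levelSpace 0 0⟩
  smul_mem' c f hf := by
    obtain ⟨n, hn⟩ := mem_iUnion.1 hf
    exact mem_iUnion.2 ⟨n, smul_mem_levelSpace c hn⟩

theorem levelResistance_mono (x y : X) : Monotone fun n => G.levelResistance n x y :=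
  fun _ _ h => biSup_mono fun _ hf => ⟨levelSpace_mono h hf.1, hf.2⟩

/-! ### The gradient -/

/-- The Hilbert sum of the spaces `L²(0, ℓ k)` over all edges. -/
abbrev EdgeL2 : Type :=
  lp (fun k : ℕ => Lp ℝ 2 (volume.restrict (Ioo 0 (G.ℓ k)))) 2

variable {G}

theorem deriv_edge_eq_zero {n k : ℕ} {f : X → ℝ} (hf : f ∈ G.levelSpace n) (h : n < k) :
    EqOn (deriv fun t => f (G.Φ k t)) 0 (Ioo 0 (G.ℓ k)) := by
  intro t ht
  rw [← eqOn_deriv_of_eqOn_Icc (eqOn_edge_of_mem_levelSpace hf h) ht]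
  simp

theorem memℓp_deriv {f : X → ℝ} (hf : f ∈ G.unionSpace) :
    Memℓp (fun k => (memHOne_of_mem_unionSpace hf k).2.toLp) 2 := by
  obtain ⟨n, hn⟩ := mem_iUnion.1 hf
  refine (memℓp_zero ((finite_Iic n).subset fun k hk => ?_)).of_exponent_ge zero_le
  by_contra hkn
  refine hk ((Lp.eq_zero_iff_ae_eq_zero).2 ?_)
  filter_upwards [(memHOne_of_mem_unionSpace hf k).2.coeFn_toLp,
    ae_restrict_mem measurableSet_Ioo] with t h1 h2
  rw [h1, deriv_edge_eq_zero hn (not_le.1 hkn) h2]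

variable (G)

/-- The gradient of a function in `unionSpace`: the family of its derivatives along the edges. -/
noncomputable def edgeGrad : G.unionSubmodule →ₗ[ℝ] G.EdgeL2 where
  toFun f := ⟨fun k => (memHOne_of_mem_unionSpace f.2 k).2.toLp, memℓp_deriv f.2⟩
  map_add' f g := by
    refine lp.ext (funext fun k => ?_)
    have h := (memHOne_of_mem_unionSpace f.2 k).deriv_add_ae (memHOne_of_mem_unionSpace g.2 k)
    exact MemLp.toLp_congr (memHOne_of_mem_unionSpace (f + g).2 k).2
      ((memHOne_of_mem_unionSpace f.2 k).2.add (memHOne_of_mem_unionSpace g.2 k).2) h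
  map_smul' c f := by
    refine lp.ext (funext fun k => ?_)
    have h := (memHOne_of_mem_unionSpace f.2 k).2
    exact MemLp.toLp_congr (memHOne_of_mem_unionSpace (c • f).2 k).2 (h.const_smul c)
      (ae_of_all _ (congrFun (MemHOne.deriv_const_mul_eq c fun t => f.1 (G.Φ k t))))

theorem edgeGrad_ae (f : G.unionSubmodule) (k : ℕ) :
    (G.edgeGrad f : ∀ k, Lp ℝ 2 (volume.restrict (Ioo 0 (G.ℓ k)))) k
      =ᵐ[volume.restrict (Ioo 0 (G.ℓ k))] deriv fun t => f.1 (G.Φ k t) :=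
  (memHOne_of_mem_unionSpace f.2 k).2.coeFn_toLp

theorem inner_edgeGrad (f g : G.unionSubmodule) :
    inner ℝ (G.edgeGrad f) (G.edgeGrad g) = G.energy f g := by
  rw [lp.inner_eq_tsum, energy]
  refine tsum_congr fun k => ?_
  rw [L2.inner_def, intervalIntegral.integral_of_le (G.ℓ_pos k).le, integral_Ioc_eq_integral_Ioo]
  refine integral_congr_ae ?_
  filter_upwards [G.edgeGrad_ae f k, G.edgeGrad_ae g k] with t h1 h2
  rw [h1, h2]
  simp [mul_comm]

theorem energy_self_eq (f : G.unionSubmodule) : G.energy f f = ‖G.edgeGrad f‖ ^ 2 := by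
  rw [← G.inner_edgeGrad, real_inner_self_eq_norm_sq]

theorem norm_edgeGrad_lipschitz_comp_le {φ : ℝ → ℝ} (hφ : LipschitzWith 1 φ)
    (f : G.unionSubmodule) : ∃ h : (fun x => φ (f.1 x)) ∈ G.unionSubmodule,
      ‖G.edgeGrad ⟨_, h⟩‖ ≤ ‖G.edgeGrad f‖ := by
  obtain ⟨n, hn⟩ := mem_iUnion.1 f.2
  refine ⟨mem_iUnion.2 ⟨n, lipschitz_comp_mem_levelSpace hφ hn⟩, ?_⟩
  refine lp.norm_mono two_ne_zero fun k => Lp.norm_le_norm_of_ae_le ?_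
  filter_upwards [G.edgeGrad_ae f k, G.edgeGrad_ae ⟨_, mem_iUnion.2 ⟨n,
    lipschitz_comp_mem_levelSpace hφ hn⟩⟩ k,
    (memHOne_of_mem_unionSpace f.2 k).abs_deriv_lipschitz_comp_le_ae hφ] with t h1 h2 h3
  rw [h1, h2]
  exact h3

/-- The integral over `(0, t]` in the edge `k`, as an inner product. -/
theorem inner_single_indicator (h : G.EdgeL2) {k : ℕ} {t : ℝ} (ht : t ∈ Ioo 0 (G.ℓ k)) :
    inner ℝ (lp.single 2 k (indicatorConstLp 2 measurableSet_Ioc (measure_ne_top _ (Ioc 0 t)) 1) :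
      G.EdgeL2) h =
        ∫ s in Ioc 0 t, (h : ∀ k, Lp ℝ 2 (volume.restrict (Ioo 0 (G.ℓ k)))) k s := by
  have hs : Ioc 0 t ⊆ Ioo 0 (G.ℓ k) := fun s hs => ⟨hs.1, hs.2.trans_lt ht.2⟩
  rw [lp.inner_single_left, L2.inner_indicatorConstLp_one, Measure.restrict_restrict
    measurableSet_Ioc, inter_eq_left.2 hs]

/-- The fundamental theorem of calculus along the edge `k`, in a form which is continuous in the
gradient. -/
theorem inner_single_indicator_edgeGrad (f : G.unionSubmodule) {k : ℕ} {t : ℝ}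
    (ht : t ∈ Ioo 0 (G.ℓ k)) :
    inner ℝ (lp.single 2 k (indicatorConstLp 2 measurableSet_Ioc (measure_ne_top _ (Ioc 0 t)) 1) :
      G.EdgeL2) (G.edgeGrad f) = f.1 (G.Φ k t) - f.1 (G.Φ k 0) := by
  have hs : Ioc 0 t ⊆ Ioo 0 (G.ℓ k) := fun s hs => ⟨hs.1, hs.2.trans_lt ht.2⟩
  rw [G.inner_single_indicator _ ht,
    integral_congr_ae (ae_restrict_of_ae_restrict_of_subset hs (G.edgeGrad_ae f k)),
    ← intervalIntegral.integral_of_le ht.1.le]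
  refine ((memHOne_of_mem_unionSpace f.2 k).1.mono ?_).integral_deriv_eq_sub
  rw [uIcc_of_le ht.1.le, uIcc_of_le (G.ℓ_pos k).le]
  exact Icc_subset_Icc_right ht.2.le

theorem eq_zero_of_inner_single_indicator (h : G.EdgeL2)
    (h0 : ∀ k, ∀ t ∈ Ioo 0 (G.ℓ k), inner ℝ (lp.single 2 k (indicatorConstLp 2 measurableSet_Ioc
      (measure_ne_top _ (Ioc 0 t)) 1) : G.EdgeL2) h = 0) : h = 0 := by
  refine lp.ext (funext fun k => (Lp.eq_zero_iff_ae_eq_zero).2 ?_)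
  refine ae_eq_zero_of_setIntegral_Ioc_eq_zero (Lp.memLp _) fun t ht => ?_
  rw [← G.inner_single_indicator h ht]
  exact h0 k t ht

end LengthSystem

/-! ### The closure of the energy -/

namespace LengthSystem

variable {X : Type*} [MetricSpace X] (G : LengthSystem X)

/-- The hypothesis under which the energy is closed to a resistance form: the effective
resistances `levelResistance n` converge to `R`, which is finite and separates points. -/
structure ResistanceLimit (R : X → X → ℝ) : Prop where
  nonneg : ∀ x y, 0 ≤ R x y
  eq_of_eq_zero : ∀ x y, R x y = 0 → x = y
  tendsto : ∀ x y, Tendsto (fun n => G.levelResistance n x y) atTop (𝓝 (ENNReal.ofReal (R x y)))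

namespace ResistanceLimit

variable {G} {R : X → X → ℝ}

theorem levelResistance_le (hR : G.ResistanceLimit R) (n : ℕ) (x y : X) :
    G.levelResistance n x y ≤ ENNReal.ofReal (R x y) :=
  (G.levelResistance_mono x y).ge_of_tendsto (hR.tendsto x y) n

/-- A function of zero energy which takes different values at `x` and `y` could be added with any
factor to a function of non-zero energy, making the resistance between `x` and `y` infinite. -/
theorem sq_sub_le (hR : G.ResistanceLimit R) (f : G.unionSubmodule) (x y : X) :
    (f.1 x - f.1 y) ^ 2 ≤ R x y * ‖G.edgeGrad f‖ ^ 2 := by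
  have key : ∀ g : G.unionSubmodule, G.edgeGrad g ≠ 0 →
      (g.1 x - g.1 y) ^ 2 ≤ R x y * ‖G.edgeGrad g‖ ^ 2 := by
    intro g hg
    have hpos : 0 < ‖G.edgeGrad g‖ ^ 2 := by positivity
    obtain ⟨n, hn⟩ := mem_iUnion.1 g.2
    have h1 : ENNReal.ofReal (|g.1 x - g.1 y| ^ 2 / G.energy g g) ≤ G.levelResistance n x y :=
      le_iSup₂_of_le g.1 ⟨hn, by rw [G.energy_self_eq]; exact hpos.ne'⟩ le_rfl
    have h2 := h1.trans (hR.levelResistance_le n x y)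
    rwa [ENNReal.ofReal_le_ofReal_iff (hR.nonneg x y), G.energy_self_eq, sq_abs,
      div_le_iff₀ hpos] at h2
  by_cases hf : G.edgeGrad f = 0
  · rw [hf, norm_zero, zero_pow two_ne_zero, mul_zero]
    by_cases hg : ∃ g, G.edgeGrad g ≠ 0
    · obtain ⟨g, hg⟩ := hg
      by_contra hne
      have hne' : f.1 x - f.1 y ≠ 0 := fun h => hne (by rw [h]; norm_num)
      set C := R x y * ‖G.edgeGrad g‖ ^ 2 with hC
      have hC0 : 0 ≤ C := mul_nonneg (hR.nonneg x y) (sq_nonneg _)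
      -- The factor is chosen so that the difference of the values becomes `C + 1`.
      let c : ℝ := (C + 1 - (g.1 x - g.1 y)) / (f.1 x - f.1 y)
      have hgrad : G.edgeGrad (g + c • f) = G.edgeGrad g := by
        rw [map_add, map_smul, hf, smul_zero, add_zero]
      have h1 := key (g + c • f) (by rwa [hgrad])
      have h2 : (g + c • f).1 x - (g + c • f).1 y = C + 1 := by
        have : c * (f.1 x - f.1 y) = C + 1 - (g.1 x - g.1 y) := div_mul_cancel₀ _ hne'
        change g.1 x + c * f.1 x - (g.1 y + c * f.1 y) = C + 1
        linarith
      rw [hgrad, h2, ← hC] at h1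
      nlinarith
    · -- If there is no function of non-zero energy, all resistances are zero.
      push Not at hg
      have h0 : ∀ n, G.levelResistance n x y = 0 := by
        intro n
        refine le_antisymm (iSup₂_le fun g hgn => ?_) zero_le
        refine absurd ?_ hgn.2
        rw [G.energy_self_eq ⟨g, mem_iUnion.2 ⟨n, hgn.1⟩⟩, hg]
        simp
      have hlim := hR.tendsto x y
      simp only [h0] at hlim
      have h1 := ENNReal.ofReal_eq_zero.1 (tendsto_nhds_unique hlim tendsto_const_nhds)
      rw [hR.eq_of_eq_zero x y (le_antisymm h1 (hR.nonneg x y))]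
      simp
  · exact key f hf

end ResistanceLimit

/-- The closure of the space of gradients of functions in `unionSpace`. -/
noncomputable abbrev gradSpace : Submodule ℝ G.EdgeL2 :=
  (LinearMap.range G.edgeGrad).topologicalClosure

/-- The gradient as a map with dense range into `gradSpace`. -/
noncomputable def gradSpaceMap : G.unionSubmodule →ₗ[ℝ] G.gradSpace :=
  G.edgeGrad.codRestrict _ fun f => Submodule.le_topologicalClosure _ ⟨f, rfl⟩

theorem denseRange_gradSpaceMap : DenseRange G.gradSpaceMap := by
  intro h
  rw [closure_subtype]
  have h2 := h.2
  rw [← SetLike.mem_coe, Submodule.topologicalClosure_coe] at h2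
  convert h2 using 2
  ext v
  constructor
  · rintro ⟨_, ⟨f, rfl⟩, rfl⟩
    exact ⟨f, rfl⟩
  · rintro ⟨f, rfl⟩
    exact ⟨_, ⟨f, rfl⟩, rfl⟩

namespace ResistanceLimit

variable {G} {R : X → X → ℝ}

theorem exists_kernel (hR : G.ResistanceLimit R) (p x : X) : ∃ v : G.gradSpace,
    ∀ f : G.unionSubmodule, inner ℝ v (G.gradSpaceMap f) = f.1 x - f.1 p := by
  let U : G.unionSubmodule →ₗ[ℝ] ℝ :=
    { toFun := fun f => f.1 x - f.1 p
      map_add' := fun f g => add_sub_add_comm _ _ _ _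
      map_smul' := fun c f => (mul_sub c _ _).symm }
  obtain ⟨v, -, hv⟩ := exists_inner_eq_of_abs_le G.gradSpaceMap U √(R x p) (Real.sqrt_nonneg _)
    fun f => by
      refine abs_le_of_sq_le_sq ?_ (by positivity)
      rw [mul_pow, Real.sq_sqrt (hR.nonneg x p)]
      exact hR.sq_sub_le f x p
  exact ⟨v, hv⟩

theorem norm_sub_sq_eq (hR : G.ResistanceLimit R) {p x y : X} {v w : G.gradSpace}
    (hv : ∀ f : G.unionSubmodule, inner ℝ v (G.gradSpaceMap f) = f.1 x - f.1 p)
    (hw : ∀ f : G.unionSubmodule, inner ℝ w (G.gradSpaceMap f) = f.1 y - f.1 p) :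
    ‖v - w‖ ^ 2 = R x y := by
  have hvw : ∀ f : G.unionSubmodule, inner ℝ (v - w) (G.gradSpaceMap f) = f.1 x - f.1 y := by
    intro f
    rw [inner_sub_left, hv, hw]
    ring
  refine le_antisymm ?_ ?_
  · have h1 : ∀ h : G.gradSpace, (inner ℝ (v - w) h : ℝ) ^ 2 ≤ R x y * ‖h‖ ^ 2 := by
      intro h
      refine G.denseRange_gradSpaceMap.induction_on h
        (isClosed_le (by fun_prop) (by fun_prop)) fun f => ?_
      rw [hvw]
      exact hR.sq_sub_le f x y
    have h2 := h1 (v - w)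
    rw [real_inner_self_eq_norm_sq, sq (‖v - w‖ ^ 2)] at h2
    rcases (sq_nonneg ‖v - w‖).eq_or_lt' with h0 | h0
    · rw [h0]
      exact hR.nonneg x y
    · exact le_of_mul_le_mul_right h2 h0
  · rw [← ENNReal.ofReal_le_ofReal_iff (sq_nonneg _)]
    refine le_of_tendsto' (hR.tendsto x y) fun n => iSup₂_le fun f hf => ?_
    let F : G.unionSubmodule := ⟨f, mem_iUnion.2 ⟨n, hf.1⟩⟩
    have hE : G.energy f f = ‖G.gradSpaceMap F‖ ^ 2 := G.energy_self_eq F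
    have hpos : 0 < ‖G.gradSpaceMap F‖ ^ 2 :=
      lt_of_le_of_ne (sq_nonneg _) (hE ▸ hf.2).symm
    refine ENNReal.ofReal_le_ofReal ?_
    rw [hE, div_le_iff₀ hpos, ← mul_pow]
    refine pow_le_pow_left₀ (abs_nonneg _) ?_ 2
    rw [show f x - f y = inner ℝ (v - w) (G.gradSpaceMap F) from (hvw F).symm]
    exact abs_real_inner_le_norm _ _

/-- Closability: a vector of `gradSpace` which is orthogonal to all kernel vectors has vanishing
integrals over all initial segments of the edges, and is zero. -/
theorem eq_zero_of_inner_kernel_eq_zero {p : X} {k : X → G.gradSpace}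
    (hk : ∀ x, ∀ f : G.unionSubmodule, inner ℝ (k x) (G.gradSpaceMap f) = f.1 x - f.1 p)
    {h : G.gradSpace} (hh : ∀ x, inner ℝ (k x) h = 0) : h = 0 := by
  refine Subtype.ext (G.eq_zero_of_inner_single_indicator h.1 fun j t ht => ?_)
  have h1 : ∀ v : G.gradSpace, inner ℝ (lp.single 2 j (indicatorConstLp 2 measurableSet_Ioc
      (measure_ne_top _ (Ioc 0 t)) 1) : G.EdgeL2) v.1 =
        (inner ℝ (k (G.Φ j t) - k (G.Φ j 0)) v : ℝ) := by
    intro v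
    refine G.denseRange_gradSpaceMap.induction_on v
      (isClosed_eq (by fun_prop) (by fun_prop)) fun f => ?_
    rw [inner_sub_left, hk, hk, sub_sub_sub_cancel_right]
    exact G.inner_single_indicator_edgeGrad f ht
  rw [h1, inner_sub_left, hh, hh, sub_zero]

theorem exists_kernelRealization (hR : G.ResistanceLimit R) :
    ∃ A : KernelRealization G.unionSubmodule G.gradSpace, A.grad = G.gradSpaceMap ∧
      ∀ x y, ‖A.kernel x - A.kernel y‖ ^ 2 = R x y := by
  choose k hk using hR.exists_kernel (G.Φ 0 0)
  have hnorm : ∀ x y, ‖k x - k y‖ ^ 2 = R x y := fun x y => hR.norm_sub_sq_eq (hk x) (hk y)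
  refine ⟨{
    grad := G.gradSpaceMap
    denseRange := G.denseRange_gradSpaceMap
    base := G.Φ 0 0
    kernel := k
    inner_kernel_grad := fun f x => hk x f
    kernel_injective := fun x y hxy => hR.eq_of_eq_zero x y (by simp [← hnorm, hxy])
    total := fun h hh => eq_zero_of_inner_kernel_eq_zero hk hh
    const_mem := fun c => mem_iUnion.2 ⟨0, const_mem_levelSpace 0 c⟩
    markov := G.norm_edgeGrad_lipschitz_comp_le lipschitzWith_unit_truncation }, rfl, hnorm⟩

theorem triangle (hR : G.ResistanceLimit R) (x y z : X) : R x z ≤ R x y + R y z := by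
  obtain ⟨A, -, hA⟩ := hR.exists_kernelRealization
  simpa only [hA] using A.norm_kernel_sub_sq_triangle x y z

theorem exists_resistanceForm (hR : G.ResistanceLimit R) :
    ∃ E : ResistanceForm X, (∀ x y, E.resistance x y = R x y) ∧
      (∃ h : G.unionSpace ⊆ E.dom, ∀ f, ∀ hf : f ∈ G.unionSpace,
        E.form ⟨f, h hf⟩ ⟨f, h hf⟩ = G.energy f f) ∧
      ∀ g : E.dom, ∃ f : ℕ → E.dom, (∀ i, (f i : X → ℝ) ∈ G.unionSpace) ∧
        Tendsto (fun i => E.form (f i - g) (f i - g)) atTop (𝓝 0) := by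
  obtain ⟨A, hgrad, hA⟩ := hR.exists_kernelRealization
  refine ⟨A.toResistanceForm, fun x y => by rw [A.toResistanceForm_resistance, hA],
    ⟨fun f hf => A.le_dom hf, fun f hf => ?_⟩, A.exists_tendsto_form_sub⟩
  have hf' : f ∈ G.unionSubmodule := hf
  have h := A.domGrad_eq_grad hf'
  rw [hgrad] at h
  refine (A.toResistanceForm_form_self _).trans ?_
  exact (congrArg (fun v => ‖v‖ ^ 2) h).trans (G.energy_self_eq ⟨f, hf'⟩).symm

end ResistanceLimit

end LengthSystem

/-! ### Resistance metrics -/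

namespace ResistanceForm

variable {X : Type*} (E : ResistanceForm X)

theorem resistance_nonneg (x y : X) : 0 ≤ E.resistance x y := by
  refine Real.sSup_nonneg ?_
  rintro r ⟨u, -, rfl⟩
  exact div_nonneg (sq_nonneg _) (E.nonneg u)

theorem resistance_self (x : X) : E.resistance x x = 0 := by
  refine le_antisymm (Real.sSup_le ?_ le_rfl) (E.resistance_nonneg x x)
  rintro r ⟨u, -, rfl⟩
  simp

theorem resistance_comm (x y : X) : E.resistance x y = E.resistance y x := by
  unfold resistance
  congr 1
  ext r
  simp only [sub_sq_comm]

theorem eq_of_resistance_eq_zero {x y : X} (h : E.resistance x y = 0) : x = y := by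
  by_contra hne
  obtain ⟨u, hu⟩ := E.separates x y hne
  have hE : E.form u u ≠ 0 := by
    intro h0
    obtain ⟨c, hc⟩ := (E.form_self_eq_zero_iff u).1 h0
    exact hu (by rw [hc, hc])
  have h1 := le_csSup (E.bddAbove x y) ⟨u, hE, rfl⟩
  have h2 : 0 < ((u : X → ℝ) x - (u : X → ℝ) y) ^ 2 / E.form u u :=
    div_pos (sq_pos_of_ne_zero (sub_ne_zero.2 hu)) (lt_of_le_of_ne (E.nonneg u) hE.symm)
  exact absurd h (h2.trans_le h1).ne'

end ResistanceForm

theorem mainTheorem4 {X : Type*} [MetricSpace X] [CompactSpace X] (G : LengthSystem X) :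
    (∃ R : X → X → ℝ, IsMetricFun R ∧ InducesTopology R ∧
      ∀ x y, Tendsto (fun n => G.levelResistance n x y) atTop (𝓝 (ENNReal.ofReal (R x y)))) ↔
    (∃ E : ResistanceForm X,
      (∀ x y, Tendsto (fun n => G.levelResistance n x y) atTop
        (𝓝 (ENNReal.ofReal (E.resistance x y)))) ∧
      InducesTopology E.resistance ∧
      (∃ h : G.unionSpace ⊆ E.dom, ∀ f, ∀ hf : f ∈ G.unionSpace,
        E.form ⟨f, h hf⟩ ⟨f, h hf⟩ = G.energy f f) ∧
      ∀ g : E.dom, ∃ f : ℕ → E.dom, (∀ i, (f i : X → ℝ) ∈ G.unionSpace) ∧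
        Tendsto (fun i => E.form (f i - g) (f i - g)) atTop (𝓝 0)) := by
  constructor
  · rintro ⟨R, hR, htop, hlim⟩
    have hL : G.ResistanceLimit R := ⟨hR.nonneg, fun x y => (hR.eq_zero_iff x y).1, hlim⟩
    obtain ⟨E, hE, hrest⟩ := hL.exists_resistanceForm
    obtain rfl : E.resistance = R := funext₂ hE
    exact ⟨E, hlim, htop, hrest⟩
  · rintro ⟨E, hlim, htop, -⟩
    have hL : G.ResistanceLimit E.resistance :=
      ⟨E.resistance_nonneg, fun _ _ => E.eq_of_resistance_eq_zero, hlim⟩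
    refine ⟨E.resistance, ⟨fun x y => ⟨E.eq_of_resistance_eq_zero, ?_⟩, E.resistance_nonneg,
      E.resistance_comm, hL.triangle⟩, htop, hlim⟩
    rintro rfl
    exact E.resistance_self x
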